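/- Let $k$ be any field. All graphs are finite and simple. For a graph $G$ with vertices $x_1,\dots,x_n$, let $R_k(G)=k[x_1,\dots,x_n]$, let $I(G)\subseteq R_k(G)$ be the ideal generated by the monomials $x_ix_j$ such that $\{x_i,x_j\}$ is an edge of $G$, and let $\mathrm{pd}(G)=\mathrm{pd}^k(G)$ denote the projective dimension of $R_k(G)/I(G)$ as an $R_k(G)$-module. (1) If $G$ is (isomorphic to) the disjoint union of two graphs $G_1$ and $G_2$, then $\mathrm{pd}(G)=\mathrm{pd}(G_1)+\mathrm{pd}(G_2)$. (2) Consequently, if $G_1,\dots,G_m$ are the connected components of a graph $G$, then $\mathrm{pd}(G)=\sum_{j=1}^m \mathrm{pd}(G_j)$. -/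

import Mathlib

universe u v

/-- The graph ideal `I(G)` of a graph `G` with vertex set `V` in the polynomial ring
`k[x_v : v ∈ V]`: it is generated by the monomials `x_a x_b` with `{a, b}` an edge of `G`. -/
noncomputable def SimpleGraph.graphIdeal (k : Type u) [Field k] {V : Type v} (G : SimpleGraph V) :
    Ideal (MvPolynomial V k) :=
  Ideal.span {p | ∃ a b : V, G.Adj a b ∧ p = MvPolynomial.X a * MvPolynomial.X b}

/-- The projective dimension of a graph `G` over the field `k`: the projective dimension of
`k[x_v : v ∈ V] / I(G)` as a module over `k[x_v : v ∈ V]`. -/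
noncomputable def SimpleGraph.pd (k : Type u) [Field k] {V : Type v} (G : SimpleGraph V) :
    WithBot ℕ∞ :=
  CategoryTheory.projectiveDimension
    (ModuleCat.of (MvPolynomial V k) (MvPolynomial V k ⧸ G.graphIdeal k))

/-!
Over a field `k`, the external tensor product of modules over two `k`-algebras `A` and `B` is exact
in each variable and preserves projectives, so tensoring resolutions shows that projective
dimension is subadditive. For the reverse inequality, suppose `A` and `B` are graded with maximal
irrelevant ideals `𝔪` and `𝔫`. In a short exact sequence `0 → K → F → M → 0` with `F` projective
and `K ≤ 𝔪 F`, every map `F ⊗ N → Y` with `𝔪 Y = 0` vanishes on `K ⊗ N`; by dimension shifting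
in `N` the same holds for all `Ext` classes, so the connecting maps
`Ext^n(K ⊗ N, Y) → Ext^(n + 1)(M ⊗ N, Y)` are injective. Graded modules have such sequences with
`K` again graded, by the graded Nakayama lemma, and iterating in both variables turns a nonzero map
from a tensor product of syzygies to a `Y` killed by `𝔪` and `𝔫` into a nonzero class of degree
`a + b` whenever `a ≤ pd M` and `b ≤ pd N`. This applies to graphs because
`k[V₁ ⊕ V₂] / I(G₁ ⊕ G₂)` is the tensor product of `k[V₁] / I(G₁)` and `k[V₂] / I(G₂)`.
-/

open CategoryTheory Abelian Limits TensorProduct DirectSum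
open scoped HomogeneousIdeal

section Biexact

universe w

variable {C₁ : Type*} [Category* C₁] [Abelian C₁] {C₂ : Type*} [Category* C₂] [Abelian C₂]
  {D : Type*} [Category* D] [Abelian D]

/-- A bifunctor between abelian categories which is exact in each variable and which sends pairs
of projective objects to projective objects; the model is the tensor product of modules over two
algebras over a field. -/
structure IsBiexact (T : C₁ ⥤ C₂ ⥤ D) : Prop where
  zero_left {X Y : C₁} (N : C₂) : (T.map (0 : X ⟶ Y)).app N = 0
  zero_right {X Y : C₂} (M : C₁) : (T.obj M).map (0 : X ⟶ Y) = 0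
  shortExact_left {S : ShortComplex C₁} (hS : S.ShortExact) (N : C₂) :
    (ShortComplex.mk ((T.map S.f).app N) ((T.map S.g).app N)
      (by rw [← NatTrans.comp_app, ← T.map_comp, S.zero, zero_left])).ShortExact
  shortExact_right {S : ShortComplex C₂} (hS : S.ShortExact) (M : C₁) :
    (ShortComplex.mk ((T.obj M).map S.f) ((T.obj M).map S.g)
      (by rw [← (T.obj M).map_comp, S.zero, zero_right])).ShortExact
  projective (P : C₁) (Q : C₂) [Projective P] [Projective Q] : Projective ((T.obj P).obj Q)

lemma exists_shortExact_projective [EnoughProjectives C₁] (X : C₁) :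
    ∃ (K P : C₁) (i : K ⟶ P) (p : P ⟶ X) (h : i ≫ p = 0),
      Projective P ∧ (ShortComplex.mk i p h).ShortExact := by
  obtain ⟨p⟩ := EnoughProjectives.presentation X
  exact ⟨_, p.p, kernel.ι p.f, p.f, kernel.condition p.f, p.projective,
    { exact := ShortComplex.exact_kernel p.f }⟩

namespace IsBiexact

variable {T : C₁ ⥤ C₂ ⥤ D}

lemma flip (hT : IsBiexact T) : IsBiexact T.flip where
  zero_left M := hT.zero_right M
  zero_right N := hT.zero_left N
  shortExact_left hS M := hT.shortExact_right hS M
  shortExact_right hS N := hT.shortExact_left hS N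
  projective Q P _ _ := hT.projective P Q

lemma isZero_of_isZero_left (hT : IsBiexact T) {M : C₁} (hM : IsZero M) (N : C₂) :
    IsZero ((T.obj M).obj N) := by
  rw [IsZero.iff_id_eq_zero, ← NatTrans.id_app, ← T.map_id, hM.eq_of_src (𝟙 M) 0, hT.zero_left]

lemma hasProjectiveDimensionLE_of_projective (hT : IsBiexact T) [EnoughProjectives C₂]
    (P : C₁) [Projective P] (N : C₂) (b : ℕ) [HasProjectiveDimensionLE N b] :
    HasProjectiveDimensionLE ((T.obj P).obj N) b := by
  induction b generalizing N with
  | zero =>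
    have : Projective N := (projective_iff_hasProjectiveDimensionLE_zero N).2 ‹_›
    exact (projective_iff_hasProjectiveDimensionLE_zero _).1 (hT.projective P N)
  | succ b ih =>
    obtain ⟨K, Q, i, p, h, _, hS⟩ := exists_shortExact_projective N
    have : HasProjectiveDimensionLE K b :=
      (hS.hasProjectiveDimensionLT_X₃_iff b ‹_›).1 ‹_›
    exact ((hT.shortExact_right hS P).hasProjectiveDimensionLT_X₃_iff b
      (hT.projective P Q)).2 (ih K)

lemma hasProjectiveDimensionLE_add (hT : IsBiexact T) [EnoughProjectives C₁] [EnoughProjectives C₂]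
    (M : C₁) (N : C₂) (a b : ℕ) [HasProjectiveDimensionLE M a] [HasProjectiveDimensionLE N b] :
    HasProjectiveDimensionLE ((T.obj M).obj N) (a + b) := by
  induction a generalizing M with
  | zero =>
    have : Projective M := (projective_iff_hasProjectiveDimensionLE_zero M).2 ‹_›
    rw [zero_add]
    exact hT.hasProjectiveDimensionLE_of_projective M N b
  | succ a ih =>
    obtain ⟨K, P, i, p, h, _, hS⟩ := exists_shortExact_projective M
    have : HasProjectiveDimensionLE K a :=
      (hS.hasProjectiveDimensionLT_X₃_iff a ‹_›).1 ‹_›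
    have := hT.hasProjectiveDimensionLE_of_projective P N b
    rw [Nat.add_right_comm]
    exact (hT.shortExact_left hS N).hasProjectiveDimensionLT_X₃ (a + b + 1) (ih K)
      (hasProjectiveDimensionLT_of_ge _ (b + 1) _ (by lia))

theorem projectiveDimension_le_add (hT : IsBiexact T) [EnoughProjectives C₁]
    [EnoughProjectives C₂] (M : C₁) (N : C₂) :
    projectiveDimension ((T.obj M).obj N) ≤ projectiveDimension M + projectiveDimension N := by
  by_cases hM : IsZero M
  · exact ((projectiveDimension_eq_bot_iff _).2 (hT.isZero_of_isZero_left hM N)).trans_le bot_le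
  by_cases hN : IsZero N
  · exact ((projectiveDimension_eq_bot_iff _).2
      (hT.flip.isZero_of_isZero_left hN M)).trans_le bot_le
  rw [← projectiveDimension_eq_bot_iff] at hM hN
  obtain ⟨x, hx⟩ := WithBot.ne_bot_iff_exists.1 hM
  obtain ⟨y, hy⟩ := WithBot.ne_bot_iff_exists.1 hN
  rw [← hx, ← hy, ← WithBot.coe_add]
  cases x with
  | top => exact le_top
  | coe a =>
    cases y with
    | top => exact le_top
    | coe b =>
      have : HasProjectiveDimensionLE M a := (projectiveDimension_le_iff M a).1 hx.ge
      have : HasProjectiveDimensionLE N b := (projectiveDimension_le_iff N b).1 hy.ge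
      exact (projectiveDimension_le_iff _ (a + b)).2 (hT.hasProjectiveDimensionLE_add M N a b)

variable [HasExt.{w} D]

-- Dimension shifting in `N` reduces the vanishing to degree `0`, where it is the hypothesis.
lemma mk₀_comp_eq_zero (hT : IsBiexact T) [EnoughProjectives C₂]
    {K F : C₁} [Projective F] (i : K ⟶ F) (Y : D)
    (hi : ∀ (L : C₂) (f : (T.obj F).obj L ⟶ Y), (T.map i).app L ≫ f = 0)
    (N : C₂) (n : ℕ) (x : Ext ((T.obj F).obj N) Y n) :
    (Ext.mk₀ ((T.map i).app N)).comp x (zero_add n) = 0 := by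
  induction n generalizing N with
  | zero =>
    obtain ⟨f, rfl⟩ := Ext.homEquiv₀.symm.surjective x
    simp [hi]
  | succ n ih =>
    obtain ⟨K', Q, j, p, h, _, hS⟩ := exists_shortExact_projective N
    have := hT.projective F Q
    obtain ⟨y, rfl⟩ := Ext.contravariant_sequence_exact₃ (hT.shortExact_right hS F) Y x
      (Ext.eq_zero_of_projective _) (add_comm 1 n)
    have naturality := ShortComplex.ShortExact.extClass_naturality (hT.shortExact_right hS K)
      (hT.shortExact_right hS F)
      { τ₁ := (T.map i).app _, τ₂ := (T.map i).app _, τ₃ := (T.map i).app _ }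
    rw [← Ext.comp_assoc (a₁₂ := 1) _ _ _ (by lia) (by lia) (by lia), ← naturality,
      Ext.comp_assoc (a₂₃ := n) _ _ _ (by lia) (by lia) (by lia), ih, Ext.comp_zero]

lemma nontrivial_ext_succ (hT : IsBiexact T) [EnoughProjectives C₂]
    {S : ShortComplex C₁} (hS : S.ShortExact) [Projective S.X₂] (Y : D)
    (hi : ∀ (L : C₂) (f : (T.obj S.X₂).obj L ⟶ Y), (T.map S.f).app L ≫ f = 0)
    (N : C₂) (n : ℕ) [Nontrivial (Ext ((T.obj S.X₁).obj N) Y n)] :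
    Nontrivial (Ext ((T.obj S.X₃).obj N) Y (n + 1)) := by
  obtain ⟨x, hx⟩ := exists_ne (0 : Ext ((T.obj S.X₁).obj N) Y n)
  refine ⟨(hT.shortExact_left hS N).extClass.comp x (add_comm 1 n), 0, fun h ↦ hx ?_⟩
  obtain ⟨y, rfl⟩ := Ext.contravariant_sequence_exact₁ (hT.shortExact_left hS N) Y x _ h
  exact hT.mk₀_comp_eq_zero S.f Y hi N n y

end IsBiexact

end Biexact

section ExternalModule

variable (k A B M N : Type*) [CommRing k] [CommRing A] [CommRing B] [Algebra k A] [Algebra k B]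
  [AddCommGroup M] [Module k M] [Module A M] [IsScalarTower k A M]
  [AddCommGroup N] [Module k N] [Module B N] [IsScalarTower k B N]

/-- The external tensor product of an `A`-module and a `B`-module over `k`: their tensor product
over `k` as a module over `A ⊗[k] B`, with `a ⊗ₜ b` acting as `a` on the first factor and as `b`
on the second. It is not a global instance, as it would compete with the actions of the factors. -/
@[reducible]
noncomputable def externalModule : Module (A ⊗[k] B) (M ⊗[k] N) :=
  Module.compHom (M ⊗[k] N) (((Module.endTensorEndAlgHom (R := k) (S := k) (A := k)).comp
    (Algebra.TensorProduct.map (Algebra.lsmul k k M) (Algebra.lsmul k k N)) :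
      A ⊗[k] B →ₐ[k] Module.End k (M ⊗[k] N)) : A ⊗[k] B →+* Module.End k (M ⊗[k] N))

attribute [local instance] externalModule

variable {k A B M N}

lemma external_smul_tmul (a : A) (b : B) (m : M) (n : N) :
    (a ⊗ₜ[k] b) • (m ⊗ₜ[k] n) = (a • m) ⊗ₜ[k] (b • n) := rfl

lemma external_map_smul {P : Type*} [AddCommGroup P] [Module (A ⊗[k] B) P]
    (f : M ⊗[k] N →+ P)
    (hf : ∀ (a : A) (b : B) (m : M) (n : N),
      f ((a • m) ⊗ₜ[k] (b • n)) = (a ⊗ₜ[k] b) • f (m ⊗ₜ[k] n))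
    (c : A ⊗[k] B) (x : M ⊗[k] N) : f (c • x) = c • f x := by
  induction c with
  | zero => simp
  | add c c' h h' => rw [add_smul, map_add, h, h', add_smul]
  | tmul a b =>
    induction x with
    | zero => simp
    | add x y h h' => rw [smul_add, map_add, h, h', map_add, smul_add]
    | tmul m n => rw [external_smul_tmul, hf]

section Map

variable {M' N' M'' N'' : Type*} [AddCommGroup M'] [Module k M'] [Module A M']
  [IsScalarTower k A M'] [AddCommGroup N'] [Module k N'] [Module B N'] [IsScalarTower k B N']
  [AddCommGroup M''] [Module k M''] [Module A M''] [IsScalarTower k A M'']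
  [AddCommGroup N''] [Module k N''] [Module B N''] [IsScalarTower k B N'']

/-- The tensor product of an `A`-linear and a `B`-linear map, as an `A ⊗[k] B`-linear map between
external tensor products. -/
noncomputable def externalMap (f : M →ₗ[A] M') (g : N →ₗ[B] N') :
    M ⊗[k] N →ₗ[A ⊗[k] B] M' ⊗[k] N' where
  toFun := TensorProduct.map (f.restrictScalars k) (g.restrictScalars k)
  map_add' := map_add _
  map_smul' := external_map_smul
    (TensorProduct.map (f.restrictScalars k) (g.restrictScalars k)).toAddMonoidHom
    (fun a b m n ↦ by simp [external_smul_tmul])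

lemma external_hom_ext {P : Type*} [AddCommGroup P] [Module (A ⊗[k] B) P]
    {f g : M ⊗[k] N →ₗ[A ⊗[k] B] P} (h : ∀ m n, f (m ⊗ₜ n) = g (m ⊗ₜ n)) : f = g := by
  ext x
  induction x with
  | zero => rw [map_zero, map_zero]
  | add x y hx hy => rw [map_add, map_add, hx, hy]
  | tmul m n => exact h m n

lemma externalMap_id :
    externalMap (k := k) (.id : M →ₗ[A] M) (.id : N →ₗ[B] N) = .id :=
  external_hom_ext fun _ _ ↦ rfl

lemma externalMap_comp (f : M →ₗ[A] M') (f' : M' →ₗ[A] M'') (g : N →ₗ[B] N')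
    (g' : N' →ₗ[B] N'') :
    externalMap (k := k) (f' ∘ₗ f) (g' ∘ₗ g) = externalMap f' g' ∘ₗ externalMap f g :=
  external_hom_ext fun _ _ ↦ rfl

lemma externalMap_surjective {f : M →ₗ[A] M'} {g : N →ₗ[B] N'} (hf : Function.Surjective f)
    (hg : Function.Surjective g) : Function.Surjective (externalMap (k := k) f g) :=
  TensorProduct.map_surjective (g := f.restrictScalars k) (g' := g.restrictScalars k) hf hg

end Map

lemma projective_external_finsupp (ι κ : Type*) :
    Module.Projective (A ⊗[k] B) ((ι →₀ A) ⊗[k] (κ →₀ B)) := by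
  let e := finsuppTensorFinsupp k k A B ι κ
  let e' : (ι →₀ A) ⊗[k] (κ →₀ B) ≃ₗ[A ⊗[k] B] (ι × κ →₀ A ⊗[k] B) :=
    { e with
      map_smul' := external_map_smul e.toLinearMap.toAddMonoidHom (fun a b f g ↦ by
        ext ⟨i, j⟩
        simp [e, finsuppTensorFinsupp_apply]) }
  exact .of_equiv e'.symm

lemma projective_external [Module.Projective A M] [Module.Projective B N] :
    Module.Projective (A ⊗[k] B) (M ⊗[k] N) := by
  obtain ⟨s, hs⟩ := Module.projective_def'.1 ‹Module.Projective A M›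
  obtain ⟨t, ht⟩ := Module.projective_def'.1 ‹Module.Projective B N›
  have := projective_external_finsupp (k := k) (A := A) (B := B) M N
  refine .of_split (externalMap (k := k) s t)
    (externalMap (Finsupp.linearCombination A id) (Finsupp.linearCombination B id)) ?_
  rw [← externalMap_comp, hs, ht, externalMap_id]

section Ideal

variable {𝔪 : Ideal A} {𝔫 : Ideal B}

lemma tmul_mem_map_includeLeft_smul_top {x : M} (hx : x ∈ 𝔪 • (⊤ : Submodule A M)) (n : N) :
    x ⊗ₜ n ∈ 𝔪.map (Algebra.TensorProduct.includeLeft : A →ₐ[k] A ⊗[k] B) •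
      (⊤ : Submodule (A ⊗[k] B) (M ⊗[k] N)) := by
  induction hx using Submodule.smul_induction_on' with
  | smul a ha y _ =>
    have := Submodule.smul_mem_smul
      (Ideal.mem_map_of_mem (Algebra.TensorProduct.includeLeft : A →ₐ[k] A ⊗[k] B) ha)
      (Submodule.mem_top (x := y ⊗ₜ[k] n))
    simpa [external_smul_tmul] using this
  | add x _ y _ hx hy => simpa [add_tmul] using add_mem hx hy

lemma tmul_mem_map_includeRight_smul_top (m : M) {x : N} (hx : x ∈ 𝔫 • (⊤ : Submodule B N)) :
    m ⊗ₜ x ∈ 𝔫.map (Algebra.TensorProduct.includeRight : B →ₐ[k] A ⊗[k] B) •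
      (⊤ : Submodule (A ⊗[k] B) (M ⊗[k] N)) := by
  induction hx using Submodule.smul_induction_on' with
  | smul b hb y _ =>
    have := Submodule.smul_mem_smul
      (Ideal.mem_map_of_mem (Algebra.TensorProduct.includeRight : B →ₐ[k] A ⊗[k] B) hb)
      (Submodule.mem_top (x := m ⊗ₜ[k] y))
    simpa [external_smul_tmul] using this
  | add x _ y _ hx hy => simpa [tmul_add] using add_mem hx hy

lemma map_includeLeft_le_annihilator (h : 𝔪 ≤ Module.annihilator A M) :
    𝔪.map (Algebra.TensorProduct.includeLeft : A →ₐ[k] A ⊗[k] B) ≤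
      Module.annihilator (A ⊗[k] B) (M ⊗[k] N) := by
  refine Ideal.map_le_iff_le_comap.2 fun a ha ↦ Module.mem_annihilator.2 fun x ↦ ?_
  induction x with
  | zero => rw [smul_zero]
  | add x y hx hy => rw [smul_add, hx, hy, add_zero]
  | tmul m n => simp [external_smul_tmul, Module.mem_annihilator.1 (h ha) m]

lemma map_includeRight_le_annihilator (h : 𝔫 ≤ Module.annihilator B N) :
    𝔫.map (Algebra.TensorProduct.includeRight : B →ₐ[k] A ⊗[k] B) ≤
      Module.annihilator (A ⊗[k] B) (M ⊗[k] N) := by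
  refine Ideal.map_le_iff_le_comap.2 fun b hb ↦ Module.mem_annihilator.2 fun x ↦ ?_
  induction x with
  | zero => rw [smul_zero]
  | add x y hx hy => rw [smul_add, hx, hy, add_zero]
  | tmul m n => simp [external_smul_tmul, Module.mem_annihilator.1 (h hb) n]

end Ideal

end ExternalModule

section ExternalTensor

open scoped ModuleCat

variable (k : Type*) (A B : Type u) [Field k] [CommRing A] [CommRing B] [Algebra k A]
  [Algebra k B]

attribute [local instance] externalModule

/-- The external tensor product over a field, as a bifunctor. -/
noncomputable def externalTensor :
    ModuleCat.{u} A ⥤ ModuleCat.{u} B ⥤ ModuleCat.{u} (A ⊗[k] B) where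
  obj M :=
    { obj N := .of (A ⊗[k] B) (M ⊗[k] N)
      map g := ModuleCat.ofHom (externalMap .id g.hom)
      map_id _ := ModuleCat.hom_ext externalMap_id
      map_comp g g' := ModuleCat.hom_ext (externalMap_comp .id .id g.hom g'.hom) }
  map f :=
    { app N := ModuleCat.ofHom (externalMap f.hom .id)
      naturality _ _ _ := ModuleCat.hom_ext (external_hom_ext fun _ _ ↦ rfl) }
  map_id _ := by
    ext N : 2
    exact ModuleCat.hom_ext externalMap_id
  map_comp f f' := by
    ext N : 2
    exact ModuleCat.hom_ext (externalMap_comp f.hom f'.hom .id .id)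

lemma externalTensor_isBiexact : IsBiexact (externalTensor k A B) where
  zero_left N :=
    ModuleCat.hom_ext (external_hom_ext fun _ _ ↦ zero_tmul _ _)
  zero_right M :=
    ModuleCat.hom_ext (external_hom_ext fun _ _ ↦ tmul_zero _ _)
  shortExact_left {S} hS N := by
    have hf := (ModuleCat.mono_iff_injective _).1 hS.mono_f
    have hg := (ModuleCat.epi_iff_surjective _).1 hS.epi_g
    have hfg := (ShortComplex.ShortExact.moduleCat_exact_iff_function_exact S).1 hS.exact
    exact ModuleCat.shortComplex_shortExact _
      (rTensor_exact N (f := S.f.hom.restrictScalars k) (g := S.g.hom.restrictScalars k) hfg hg)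
      (Module.Flat.rTensor_preserves_injective_linearMap (S.f.hom.restrictScalars k) hf)
      (LinearMap.rTensor_surjective N (g := S.g.hom.restrictScalars k) hg)
  shortExact_right {S} hS M := by
    have hf := (ModuleCat.mono_iff_injective _).1 hS.mono_f
    have hg := (ModuleCat.epi_iff_surjective _).1 hS.epi_g
    have hfg := (ShortComplex.ShortExact.moduleCat_exact_iff_function_exact S).1 hS.exact
    exact ModuleCat.shortComplex_shortExact _
      (lTensor_exact M (f := S.f.hom.restrictScalars k) (g := S.g.hom.restrictScalars k) hfg hg)
      (Module.Flat.lTensor_preserves_injective_linearMap (S.f.hom.restrictScalars k) hf)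
      (LinearMap.lTensor_surjective M (g := S.g.hom.restrictScalars k) hg)
  projective P Q _ _ := by
    have : Module.Projective A P := (IsProjective.iff_projective P).2 ‹_›
    have : Module.Projective B Q := (IsProjective.iff_projective Q).2 ‹_›
    exact (IsProjective.iff_projective _).1 projective_external

end ExternalTensor

lemma withBot_enat_add_le {x y z : WithBot ℕ∞}
    (h : ∀ a b : ℕ, a ≤ x → b ≤ y → ((a + b : ℕ) : WithBot ℕ∞) ≤ z) : x + y ≤ z := by
  cases x with
  | bot => simp
  | coe x =>
  cases y with
  | bot => simp
  | coe y =>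
  have h₀ := h 0 0 (WithBot.coe_le_coe.2 bot_le) (WithBot.coe_le_coe.2 bot_le)
  cases z with
  | bot => simp at h₀
  | coe z =>
  norm_cast at h ⊢
  cases x with
  | top => exact le_top.trans (ENat.forall_natCast_le_iff_le.1 fun a _ ↦ h a 0 le_top bot_le)
  | coe a =>
  cases y with
  | top =>
    exact le_top.trans (ENat.forall_natCast_le_iff_le.1 fun b _ ↦
      (Nat.cast_le.2 (Nat.le_add_left b a)).trans (h a b le_rfl le_top))
  | coe b => exact_mod_cast h a b le_rfl le_rfl

section MinimalSyzygy

/-- `HasMinimalSyzygy 𝔪 n M` says that `M` has an `n`-th syzygy `K`, taken in a resolution by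
projective modules that is minimal with respect to the ideal `𝔪`, such that `𝔪 K ≠ K`. -/
inductive HasMinimalSyzygy {A : Type u} [CommRing A] (𝔪 : Ideal A) : ℕ → ModuleCat.{u} A → Prop
  | zero (M : ModuleCat.{u} A) (hM : 𝔪 • (⊤ : Submodule A M) ≠ ⊤) : HasMinimalSyzygy 𝔪 0 M
  | succ (n : ℕ) (S : ShortComplex (ModuleCat.{u} A)) (hS : S.ShortExact) (hP : Projective S.X₂)
      (hmin : LinearMap.range S.f.hom ≤ 𝔪 • (⊤ : Submodule A S.X₂))
      (h : HasMinimalSyzygy 𝔪 n S.X₁) : HasMinimalSyzygy 𝔪 (n + 1) S.X₃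

lemma smul_top_le_ker_of_le_annihilator {R M N : Type*} [CommRing R] [AddCommGroup M] [Module R M]
    [AddCommGroup N] [Module R N] {I : Ideal R} (hI : I ≤ Module.annihilator R N)
    (f : M →ₗ[R] N) : I • (⊤ : Submodule R M) ≤ LinearMap.ker f :=
  Submodule.smul_le.2 fun r hr x _ ↦ by
    rw [LinearMap.mem_ker, map_smul, Module.mem_annihilator.1 (hI hr)]

open scoped ModuleCat

attribute [local instance] externalModule

variable {k : Type*} {A B : Type u} [Field k] [CommRing A] [CommRing B] [Algebra k A] [Algebra k B]
  {𝔪 : Ideal A} {𝔫 : Ideal B}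

lemma externalTensor_map_app_comp_eq_zero {K F : ModuleCat.{u} A} (i : K ⟶ F)
    (hi : LinearMap.range i.hom ≤ 𝔪 • (⊤ : Submodule A F)) {Y : ModuleCat.{u} (A ⊗[k] B)}
    (hY : 𝔪.map (Algebra.TensorProduct.includeLeft : A →ₐ[k] A ⊗[k] B) ≤
      Module.annihilator (A ⊗[k] B) Y)
    (L : ModuleCat.{u} B) (f : ((externalTensor k A B).obj F).obj L ⟶ Y) :
    ((externalTensor k A B).map i).app L ≫ f = 0 :=
  ModuleCat.hom_ext <| external_hom_ext fun x l ↦ smul_top_le_ker_of_le_annihilator hY f.hom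
    (tmul_mem_map_includeLeft_smul_top (hi ⟨x, rfl⟩) l)

lemma externalTensor_obj_map_comp_eq_zero {K F : ModuleCat.{u} B} (i : K ⟶ F)
    (hi : LinearMap.range i.hom ≤ 𝔫 • (⊤ : Submodule B F)) {Y : ModuleCat.{u} (A ⊗[k] B)}
    (hY : 𝔫.map (Algebra.TensorProduct.includeRight : B →ₐ[k] A ⊗[k] B) ≤
      Module.annihilator (A ⊗[k] B) Y)
    (L : ModuleCat.{u} A) (f : ((externalTensor k A B).obj L).obj F ⟶ Y) :
    ((externalTensor k A B).obj L).map i ≫ f = 0 :=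
  ModuleCat.hom_ext <| external_hom_ext fun l x ↦ smul_top_le_ker_of_le_annihilator hY f.hom
    (tmul_mem_map_includeRight_smul_top l (hi ⟨x, rfl⟩))

lemma exists_externalTensor_hom_ne_zero {M : ModuleCat.{u} A} {N : ModuleCat.{u} B}
    (hM : 𝔪 • (⊤ : Submodule A M) ≠ ⊤) (hN : 𝔫 • (⊤ : Submodule B N) ≠ ⊤) :
    ∃ Y : ModuleCat.{u} (A ⊗[k] B),
      𝔪.map (Algebra.TensorProduct.includeLeft : A →ₐ[k] A ⊗[k] B) ≤ Module.annihilator _ Y ∧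
      𝔫.map (Algebra.TensorProduct.includeRight : B →ₐ[k] A ⊗[k] B) ≤ Module.annihilator _ Y ∧
      ∃ f : ((externalTensor k A B).obj M).obj N ⟶ Y, f ≠ 0 := by
  let M' := ModuleCat.of A (M ⧸ 𝔪 • (⊤ : Submodule A M))
  let N' := ModuleCat.of B (N ⧸ 𝔫 • (⊤ : Submodule B N))
  have : Nontrivial M' := Submodule.Quotient.nontrivial_iff.2 hM
  have : Nontrivial N' := Submodule.Quotient.nontrivial_iff.2 hN
  let p : M →ₗ[A] M' := Submodule.mkQ _
  let q : N →ₗ[B] N' := Submodule.mkQ _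
  let f : M ⊗[k] N →ₗ[A ⊗[k] B] M' ⊗[k] N' := externalMap p q
  have hf : Function.Surjective f :=
    externalMap_surjective (Submodule.mkQ_surjective _) (Submodule.mkQ_surjective _)
  refine ⟨((externalTensor k A B).obj M').obj N',
    map_includeLeft_le_annihilator ((Module.isTorsionBySet_iff_subset_annihilator _ _).1
      (Module.isTorsionBySet_quotient_ideal_smul M 𝔪)),
    map_includeRight_le_annihilator ((Module.isTorsionBySet_iff_subset_annihilator _ _).1
      (Module.isTorsionBySet_quotient_ideal_smul N 𝔫)), ModuleCat.ofHom f,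
    fun h ↦ ?_⟩
  obtain ⟨y, hy⟩ := exists_ne (0 : M' ⊗[k] N')
  obtain ⟨x, rfl⟩ := hf y
  exact hy (LinearMap.congr_fun (congrArg ModuleCat.Hom.hom h) x)

-- The connecting maps of the minimal syzygy sequences, first of `M` and then of `N`, are injective
-- on `Ext(-, Y)`, so a nonzero map between the last syzygies and `Y` climbs up to degree `a + b`.
lemma HasMinimalSyzygy.exists_nontrivial_ext {M : ModuleCat.{u} A} {N : ModuleCat.{u} B}
    {a b : ℕ} (hM : HasMinimalSyzygy 𝔪 a M) (hN : HasMinimalSyzygy 𝔫 b N) :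
    ∃ Y : ModuleCat.{u} (A ⊗[k] B),
      𝔪.map (Algebra.TensorProduct.includeLeft : A →ₐ[k] A ⊗[k] B) ≤ Module.annihilator _ Y ∧
      𝔫.map (Algebra.TensorProduct.includeRight : B →ₐ[k] A ⊗[k] B) ≤ Module.annihilator _ Y ∧
      Nontrivial (Ext (((externalTensor k A B).obj M).obj N) Y (a + b)) := by
  have hT := externalTensor_isBiexact k A B
  induction hM with
  | zero M hM =>
    induction hN with
    | zero N hN =>
      obtain ⟨Y, hY₁, hY₂, f, hf⟩ := exists_externalTensor_hom_ne_zero (k := k) hM hN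
      exact ⟨Y, hY₁, hY₂, Ext.homEquiv₀.nontrivial_congr.2 ⟨f, 0, hf⟩⟩
    | succ n S hS hP hmin _ ih =>
      obtain ⟨Y, hY₁, hY₂, hExt⟩ := ih
      rw [zero_add] at hExt ⊢
      have : Nontrivial (Ext (((externalTensor k A B).flip.obj S.X₁).obj M) Y n) := hExt
      exact ⟨Y, hY₁, hY₂, hT.flip.nontrivial_ext_succ hS Y
        (externalTensor_obj_map_comp_eq_zero S.f hmin hY₂) M n⟩
  | succ n S hS hP hmin _ ih =>
    obtain ⟨Y, hY₁, hY₂, hExt⟩ := ih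
    rw [Nat.add_right_comm]
    exact ⟨Y, hY₁, hY₂, hT.nontrivial_ext_succ hS Y
      (externalTensor_map_app_comp_eq_zero S.f hmin hY₁) N (n + b)⟩

theorem projectiveDimension_externalTensor (M : ModuleCat.{u} A) (N : ModuleCat.{u} B)
    (hM : ∀ n, ¬ HasProjectiveDimensionLT M n → HasMinimalSyzygy 𝔪 n M)
    (hN : ∀ n, ¬ HasProjectiveDimensionLT N n → HasMinimalSyzygy 𝔫 n N) :
    projectiveDimension (((externalTensor k A B).obj M).obj N) =
      projectiveDimension M + projectiveDimension N := by
  refine le_antisymm ((externalTensor_isBiexact k A B).projectiveDimension_le_add M N)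
    (withBot_enat_add_le fun a b ha hb ↦ ?_)
  rw [projectiveDimension_ge_iff] at ha hb ⊢
  intro h
  obtain ⟨Y, -, -, hY⟩ := (hM a ha).exists_nontrivial_ext (k := k) (hN b hb)
  exact not_subsingleton _ (h.subsingleton _ _ (a + b) le_rfl Y)

end MinimalSyzygy

section Graded

variable {A : Type*} [CommRing A] {σ : Type*} [SetLike σ A] {𝒜 : ℕ → σ}
  {M : Type*} [AddCommGroup M] [Module A M] {τ : Type*} [SetLike τ M] [AddSubmonoidClass τ M]
  {ℳ : ℕ → τ} [Decomposition ℳ]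

lemma coe_decompose_of_mem {m n : ℕ} {x : M} (hx : x ∈ ℳ m) :
    (decompose ℳ x n : M) = if m = n then x else 0 := by
  split_ifs with h
  · exact h ▸ decompose_of_mem_same ℳ hx
  · exact decompose_of_mem_ne ℳ hx h

lemma coe_decompose_smul [SetLike.GradedSMul 𝒜 ℳ] {i : ℕ} {a : A} (ha : a ∈ 𝒜 i) (x : M) (n : ℕ) :
    (decompose ℳ (a • x) n : M) = if i ≤ n then a • (decompose ℳ x (n - i) : M) else 0 := by
  induction x using Decomposition.inductionOn ℳ with
  | zero => simp
  | @homogeneous m x =>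
    rw [coe_decompose_of_mem (SetLike.GradedSMul.smul_mem ha x.2), coe_decompose_of_mem x.2,
      vadd_eq_add]
    grind [smul_zero]
  | add x y hx hy =>
    simp only [decompose_add, DirectSum.add_apply, AddMemClass.coe_add, hx, hy, smul_add]
    split_ifs <;> simp

section Irrelevant

variable [AddSubmonoidClass σ A] [GradedRing 𝒜] [SetLike.GradedSMul 𝒜 ℳ]

lemma decompose_mem_of_mem_irrelevant_smul {N K : Submodule A M} {n : ℕ}
    (hN : ∀ m < n, ∀ x ∈ K, (decompose ℳ x m : M) ∈ N) {x : M}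
    (hx : x ∈ 𝒜₊.toIdeal • K) : (decompose ℳ x n : M) ∈ N := by
  induction hx using Submodule.smul_induction_on' with
  | smul a ha y hy =>
    have ha' : a ∈ AddSubmonoid.closure (⋃ i > 0, (𝒜 i : Set A)) :=
      HomogeneousIdeal.irrelevant_eq_closure 𝒜 ▸ ha
    clear ha
    induction ha' using AddSubmonoid.closure_induction with
    | zero => simp
    | add a b _ _ ha hb => simpa [add_smul] using add_mem ha hb
    | mem a ha =>
      obtain ⟨i, hi, ha⟩ : ∃ i > 0, a ∈ 𝒜 i := by simpa using ha
      rw [coe_decompose_smul ha]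
      split_ifs with h
      · exact N.smul_mem a (hN _ (by lia) y hy)
      · exact N.zero_mem
  | add x _ y _ hx hy => simpa using add_mem hx hy

-- Graded Nakayama lemma: the degrees are bounded below, so induction on the degree replaces
-- finite generation.
lemma le_of_le_sup_irrelevant_smul {N K : Submodule A M}
    (hN : N.IsHomogeneous ℳ) (hK : K ≤ N ⊔ 𝒜₊.toIdeal • K) :
    K ≤ N := by
  have hdecompose (n : ℕ) : ∀ x ∈ K, (decompose ℳ x n : M) ∈ N := by
    induction n using Nat.strong_induction_on with
    | h n ih =>
      intro x hx
      obtain ⟨y, hy, z, hz, rfl⟩ := Submodule.mem_sup.1 (hK hx)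
      rw [decompose_add, DirectSum.add_apply, AddMemClass.coe_add]
      exact add_mem (hN n hy) (decompose_mem_of_mem_irrelevant_smul ih hz)
  exact fun x hx ↦ (hN.mem_iff ℳ).2 fun n ↦ hdecompose n x hx

end Irrelevant

section Map

variable {N : Type*} [AddCommGroup N] [Module A N] {υ : Type*} [SetLike υ N]
  [AddSubmonoidClass υ N] {𝒩 : ℕ → υ} [Decomposition 𝒩] {f : M →ₗ[A] N}

lemma coe_decompose_map (hf : ∀ n, ∀ x ∈ ℳ n, f x ∈ 𝒩 n) (x : M) (n : ℕ) :
    (decompose 𝒩 (f x) n : N) = f (decompose ℳ x n) := by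
  induction x using Decomposition.inductionOn ℳ with
  | zero => simp
  | @homogeneous m x =>
    rw [coe_decompose_of_mem (hf m x x.2), coe_decompose_of_mem x.2]
    split_ifs <;> simp
  | add x y hx hy => simp [hx, hy]

lemma isHomogeneous_ker (hf : ∀ n, ∀ x ∈ ℳ n, f x ∈ 𝒩 n) :
    (LinearMap.ker f).IsHomogeneous ℳ := fun n x hx ↦ by
  rw [LinearMap.mem_ker, ← coe_decompose_map hf, LinearMap.mem_ker.1 hx, decompose_zero,
    DirectSum.zero_apply, ZeroMemClass.coe_zero]

lemma isHomogeneous_range (hf : ∀ n, ∀ x ∈ ℳ n, f x ∈ 𝒩 n) :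
    (LinearMap.range f).IsHomogeneous 𝒩 := by
  rintro n _ ⟨x, rfl⟩
  exact ⟨_, (coe_decompose_map hf x n).symm⟩

end Map

end Graded

section FreeGrading

variable {A : Type*} [CommRing A] {σ : Type*} [SetLike σ A] {ι : Type*}

/-- The grading of the free module on generators indexed by `ι` for which the generator `i` has
degree `d i`. It is spanned by single-generator terms, which avoids subtracting degrees. -/
noncomputable def freeGrading (𝒜 : ℕ → σ) (d : ι → ℕ) (n : ℕ) : AddSubmonoid (ι →₀ A) :=
  .closure {f | ∃ (i : ι) (m : ℕ) (a : A), a ∈ 𝒜 m ∧ m + d i = n ∧ Finsupp.single i a = f}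

variable {𝒜 : ℕ → σ} {d : ι → ℕ}

lemma single_mem_freeGrading (i : ι) {m : ℕ} {a : A} (ha : a ∈ 𝒜 m) :
    Finsupp.single i a ∈ freeGrading 𝒜 d (m + d i) :=
  AddSubmonoid.subset_closure ⟨i, m, a, ha, rfl, rfl⟩

lemma linearCombination_mem {M : Type*} [AddCommGroup M] [Module A M] {τ : Type*} [SetLike τ M]
    [AddSubmonoidClass τ M] {ℳ : ℕ → τ} [SetLike.GradedSMul 𝒜 ℳ] {v : ι → M}
    (hv : ∀ i, v i ∈ ℳ (d i)) (n : ℕ) :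
    ∀ f ∈ freeGrading 𝒜 d n, Finsupp.linearCombination A v f ∈ ℳ n := by
  intro f hf
  induction hf using AddSubmonoid.closure_induction with
  | zero => simp
  | add f g _ _ hf hg => simpa using add_mem hf hg
  | mem f hf =>
    obtain ⟨i, m, a, ha, rfl, rfl⟩ := hf
    rw [Finsupp.linearCombination_single]
    exact SetLike.GradedSMul.smul_mem ha (hv i)

variable [AddSubmonoidClass σ A] [GradedRing 𝒜]

instance gradedSMul_freeGrading : SetLike.GradedSMul 𝒜 (freeGrading 𝒜 d) where
  smul_mem := by
    intro l n a f ha hf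
    induction hf using AddSubmonoid.closure_induction with
    | zero => simp
    | add f g _ _ hf hg => simpa using add_mem hf hg
    | mem f hf =>
      obtain ⟨i, m, b, hb, rfl, rfl⟩ := hf
      rw [Finsupp.smul_single, vadd_eq_add, ← add_assoc]
      exact single_mem_freeGrading i (SetLike.mul_mem_graded ha hb)

variable (𝒜 d) in
/-- The decomposition of an element of a graded free module into homogeneous components. -/
noncomputable def freeDecompose : (ι →₀ A) →+ ⨁ n, freeGrading 𝒜 d n :=
  Finsupp.liftAddHom fun i ↦
    (toAddMonoid fun m ↦ (DirectSum.of (fun n ↦ freeGrading 𝒜 d n) (m + d i)).comp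
      { toFun (a : 𝒜 m) := ⟨Finsupp.single i (a : A), single_mem_freeGrading i a.2⟩
        map_zero' := by ext; simp
        map_add' a b := by ext; simp }).comp
      (decomposeAddEquiv 𝒜).toAddMonoidHom

lemma freeDecompose_single (i : ι) {m : ℕ} {a : A} (ha : a ∈ 𝒜 m) :
    freeDecompose 𝒜 d (Finsupp.single i a) =
      DirectSum.of (fun n ↦ freeGrading 𝒜 d n) (m + d i)
        ⟨Finsupp.single i a, single_mem_freeGrading i ha⟩ := by
  simp [freeDecompose, decompose_of_mem 𝒜 ha]

lemma freeDecompose_of_mem {n : ℕ} {f : ι →₀ A} (hf : f ∈ freeGrading 𝒜 d n) :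
    freeDecompose 𝒜 d f = DirectSum.of (fun n ↦ freeGrading 𝒜 d n) n ⟨f, hf⟩ := by
  induction hf using AddSubmonoid.closure_induction with
  | zero => exact (map_zero _).trans (map_zero _).symm
  | add f g hf hg hf' hg' =>
    rw [map_add, hf', hg', ← map_add]
    rfl
  | mem f hf =>
    obtain ⟨i, m, a, ha, rfl, rfl⟩ := hf
    exact freeDecompose_single i ha

noncomputable instance decompositionFreeGrading : Decomposition (freeGrading 𝒜 d) :=
  .ofAddHom _ (freeDecompose 𝒜 d)
    (by
      ext i a : 2
      induction a using Decomposition.inductionOn 𝒜 with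
      | zero => simp
      | homogeneous a => simp [freeDecompose_single i a.2]
      | add a b ha hb => rw [map_add, map_add, ha, hb])
    (by
      ext n f : 2
      simp [freeDecompose_of_mem f.2])

end FreeGrading

section MinimalCover

lemma mem_smul_top_of_forall_mem {ι A : Type*} [CommRing A] {I : Ideal A} {f : ι →₀ A}
    (hf : ∀ i, f i ∈ I) : f ∈ I • (⊤ : Submodule A (ι →₀ A)) := by
  rw [← f.sum_single]
  refine Submodule.sum_mem _ fun i _ ↦ ?_
  rw [← mul_one (f i), ← smul_eq_mul, ← Finsupp.smul_single]
  exact Submodule.smul_mem_smul (hf i) trivial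

lemma exists_generators_mod_maximal {A M : Type*} {ι : Type v} [CommRing A] [AddCommGroup M]
    [Module A M]
    (𝔪 : Ideal A) [𝔪.IsMaximal] {v : ι → M} (hv : Submodule.span A (Set.range v) = ⊤) :
    ∃ (κ : Type v) (a : κ → ι),
      Submodule.span A (Set.range (v ∘ a)) ⊔ 𝔪 • ⊤ = ⊤ ∧
      LinearMap.ker (Finsupp.linearCombination A (v ∘ a)) ≤ 𝔪 • ⊤ := by
  let _ : Field (A ⧸ 𝔪) := Ideal.Quotient.field 𝔪
  let π := (𝔪 • (⊤ : Submodule A M)).mkQ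
  have span_range {κ : Type v} (w : κ → M) :
      (Submodule.span (A ⧸ 𝔪) (Set.range (π ∘ w))).restrictScalars A =
        (Submodule.span A (Set.range w)).map π := by
    rw [Submodule.restrictScalars_span A (A ⧸ 𝔪) Ideal.Quotient.mk_surjective, Set.range_comp,
      Submodule.map_span]
  obtain ⟨κ, a, -, hspan, hli⟩ := exists_linearIndependent' (A ⧸ 𝔪) (π ∘ v)
  refine ⟨κ, a, ?_, fun f hf ↦ mem_smul_top_of_forall_mem fun i ↦ ?_⟩
  · have h : (Submodule.span A (Set.range (v ∘ a))).map π = (⊤ : Submodule A M).map π :=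
      calc
        _ = (Submodule.span (A ⧸ 𝔪) (Set.range (π ∘ v))).restrictScalars A := by
          rw [← hspan, Function.comp_assoc, span_range]
        _ = _ := by rw [span_range, hv]
    rw [sup_comm, ← Submodule.comap_map_mkQ, h, Submodule.comap_map_mkQ, sup_top_eq]
  · have h : Finsupp.linearCombination (A ⧸ 𝔪) ((π ∘ v) ∘ a)
        (f.mapRange (Ideal.Quotient.mk 𝔪) (map_zero _)) = 0 := by
      have := congrArg π (LinearMap.mem_ker.1 hf)
      rw [map_zero, Finsupp.linearCombination_apply, map_finsuppSum] at this
      rw [Finsupp.linearCombination_apply, Finsupp.sum_mapRange_index (by simp)]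
      exact this
    have := DFunLike.congr_fun (linearIndependent_iff.1 hli _ h) i
    exact Ideal.Quotient.eq_zero_iff_mem.1 this

variable {A : Type u} [CommRing A] {σ : Type*} [SetLike σ A] [AddSubmonoidClass σ A]
  {𝒜 : ℕ → σ} [GradedRing 𝒜]

lemma exists_minimal_homogeneous_generators {M : Type v} [AddCommGroup M] [Module A M] {τ : Type*}
    [SetLike τ M] [AddSubmonoidClass τ M] {ℳ : ℕ → τ} [Decomposition ℳ] [SetLike.GradedSMul 𝒜 ℳ]
    (h𝔪 : 𝒜₊.toIdeal.IsMaximal) {K : Submodule A M}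
    (hK : K.IsHomogeneous ℳ) :
    ∃ (κ : Type v) (d : κ → ℕ) (v : κ → M), (∀ i, v i ∈ ℳ (d i)) ∧
      LinearMap.range (Finsupp.linearCombination A v) = K ∧
      LinearMap.ker (Finsupp.linearCombination A v) ≤
        𝒜₊.toIdeal • ⊤ := by
  let w : {x : K // ∃ n, (x : M) ∈ ℳ n} → K := Subtype.val
  have hw : Submodule.span A (Set.range w) = ⊤ := by
    refine eq_top_iff.2 fun x _ ↦ ?_
    classical
    have hx : x = ∑ n ∈ (decompose ℳ (x : M)).support, ⟨decompose ℳ (x : M) n, hK n x.2⟩ :=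
      Subtype.ext <| by
        rw [AddSubmonoidClass.coe_finsetSum, DirectSum.sum_support_decompose]
    rw [hx]
    exact Submodule.sum_mem _ fun n _ ↦ Submodule.subset_span ⟨⟨_, n, SetLike.coe_mem _⟩, rfl⟩
  obtain ⟨κ, a, hspan, hker⟩ := exists_generators_mod_maximal (𝒜₊.toIdeal) hw
  choose d hd using fun i ↦ (a i).2
  have hcomb : Finsupp.linearCombination A (K.subtype ∘ w ∘ a) =
      K.subtype ∘ₗ Finsupp.linearCombination A (w ∘ a) := by
    ext; simp
  refine ⟨κ, d, K.subtype ∘ w ∘ a, hd, le_antisymm ?_ ?_, ?_⟩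
  · rw [hcomb]
    exact (LinearMap.range_comp_le_range _ _).trans K.range_subtype.le
  · refine le_of_le_sup_irrelevant_smul (𝒜 := 𝒜) (ℳ := ℳ)
      (isHomogeneous_range (linearCombination_mem (𝒜 := 𝒜) hd)) ?_
    have := congrArg (Submodule.map K.subtype) hspan
    rw [Submodule.map_sup, Submodule.map_smul'', Submodule.map_top, Submodule.range_subtype,
      ← Finsupp.range_linearCombination, ← LinearMap.range_comp, ← hcomb] at this
    exact this.ge
  · rw [hcomb, LinearMap.ker_comp_of_ker_eq_bot _ K.ker_subtype]
    exact hker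

lemma eq_top_of_irrelevant_smul_top_quotient {M : Type*} [AddCommGroup M] [Module A M] {τ : Type*}
    [SetLike τ M] [AddSubmonoidClass τ M] {ℳ : ℕ → τ} [Decomposition ℳ] [SetLike.GradedSMul 𝒜 ℳ]
    {K : Submodule A M} (hK : K.IsHomogeneous ℳ)
    (h : 𝒜₊.toIdeal • (⊤ : Submodule A (M ⧸ K)) = ⊤) : K = ⊤ := by
  refine top_le_iff.1 (le_of_le_sup_irrelevant_smul (𝒜 := 𝒜) hK ?_)
  rw [← Submodule.comap_map_mkQ, Submodule.map_smul'', Submodule.map_top, Submodule.range_mkQ, h,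
    Submodule.comap_top]

lemma hasMinimalSyzygy_quotient_of_le (h𝔪 : 𝒜₊.toIdeal.IsMaximal)
    (n : ℕ) {F : Type u} [AddCommGroup F] [Module A F] [Module.Projective A F] {τ : Type u}
    [SetLike τ F] [AddSubmonoidClass τ F] {ℱ : ℕ → τ} [Decomposition ℱ] [SetLike.GradedSMul 𝒜 ℱ]
    {K : Submodule A F} (hK : K.IsHomogeneous ℱ)
    (hmin : K ≤ 𝒜₊.toIdeal • ⊤)
    (hn : ¬ HasProjectiveDimensionLT (ModuleCat.of A (F ⧸ K)) n) :
    HasMinimalSyzygy (𝒜₊.toIdeal) n (ModuleCat.of A (F ⧸ K)) := by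
  induction n generalizing F τ with
  | zero =>
    refine .zero _ fun h ↦ hn ?_
    rw [hasProjectiveDimensionLT_zero_iff_isZero, ModuleCat.isZero_iff_subsingleton]
    exact Submodule.Quotient.subsingleton_iff.2 (eq_top_of_irrelevant_smul_top_quotient hK h)
  | succ n ih =>
    obtain ⟨κ, d, v, hv, hrange, hker⟩ :=
      exists_minimal_homogeneous_generators (𝒜 := 𝒜) h𝔪 hK
    let q := Finsupp.linearCombination A v
    let f : ((κ →₀ A) ⧸ LinearMap.ker q) →ₗ[A] F := (LinearMap.ker q).liftQ q le_rfl
    have hf : LinearMap.range f = K := (Submodule.range_liftQ _ _ _).trans hrange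
    have hf' : Function.Injective f := LinearMap.ker_eq_bot.1 (Submodule.ker_liftQ_eq_bot' _ _ rfl)
    have hexact : Function.Exact f K.mkQ := LinearMap.exact_iff.2 (K.ker_mkQ.trans hf.symm)
    let S : ShortComplex (ModuleCat.{u} A) :=
      .mk (ModuleCat.ofHom f) (ModuleCat.ofHom K.mkQ)
        (ModuleCat.hom_ext hexact.linearMap_comp_eq_zero)
    have hS : S.ShortExact := ModuleCat.shortComplex_shortExact S hexact hf' K.mkQ_surjective
    have hP : Projective S.X₂ := (IsProjective.iff_projective F).1 ‹_›
    exact .succ n S hS hP (hf.trans_le hmin)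
      (ih (isHomogeneous_ker (linearCombination_mem (𝒜 := 𝒜) hv)) hker fun h ↦
        hn (hS.hasProjectiveDimensionLT_X₃ n h inferInstance))

lemma hasMinimalSyzygy_quotient {σ : Type u} [SetLike σ A] [AddSubmonoidClass σ A] {𝒜 : ℕ → σ}
    [GradedRing 𝒜] (h𝔪 : 𝒜₊.toIdeal.IsMaximal) {I : Ideal A}
    (hI : I.IsHomogeneous 𝒜) (n : ℕ)
    (hn : ¬ HasProjectiveDimensionLT (ModuleCat.of A (A ⧸ I)) n) :
    HasMinimalSyzygy (𝒜₊.toIdeal) n (ModuleCat.of A (A ⧸ I)) := by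
  refine hasMinimalSyzygy_quotient_of_le h𝔪 n hI ?_ hn
  rw [smul_eq_mul, Ideal.mul_top]
  by_contra h
  have hI' : (⊤ : Ideal A) ≤ I ⊔ 𝒜₊.toIdeal • ⊤ := by
    rw [smul_eq_mul, Ideal.mul_top, sup_comm, h𝔪.1.2 _ (left_lt_sup.2 h)]
  have : Subsingleton (A ⧸ I) :=
    Submodule.Quotient.subsingleton_iff.2 (top_le_iff.1 (le_of_le_sup_irrelevant_smul hI hI'))
  have : HasProjectiveDimensionLT (ModuleCat.of A (A ⧸ I)) 0 :=
    (hasProjectiveDimensionLT_zero_iff_isZero _).2 (ModuleCat.isZero_of_subsingleton _)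
  exact hn (hasProjectiveDimensionLT_of_ge _ 0 n n.zero_le)

end MinimalCover

section Quotient

attribute [local instance] externalModule

section Cyclic

variable {k A B M N : Type*} [CommRing k] [CommRing A] [CommRing B] [Algebra k A] [Algebra k B]
  [AddCommGroup M] [Module k M] [Module A M] [IsScalarTower k A M]
  [AddCommGroup N] [Module k N] [Module B N] [IsScalarTower k B N]
  (f : A →ₗ[A] M) (g : B →ₗ[B] N)

lemma toSpanSingleton_tmul_apply (x : A ⊗[k] B) :
    LinearMap.toSpanSingleton (A ⊗[k] B) (M ⊗[k] N) (f 1 ⊗ₜ g 1) x =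
      TensorProduct.map (f.restrictScalars k) (g.restrictScalars k) x := by
  induction x with
  | zero => simp
  | add x y hx hy => rw [map_add, hx, hy, map_add]
  | tmul a b => simp [external_smul_tmul, ← map_smul]

variable {f g}

lemma toSpanSingleton_tmul_surjective (hf : Function.Surjective f) (hg : Function.Surjective g) :
    Function.Surjective (LinearMap.toSpanSingleton (A ⊗[k] B) (M ⊗[k] N) (f 1 ⊗ₜ g 1)) :=
  (funext (toSpanSingleton_tmul_apply (k := k) f g) :) ▸
    TensorProduct.map_surjective (g := f.restrictScalars k) (g' := g.restrictScalars k) hf hg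

lemma ker_toSpanSingleton_tmul (hf : Function.Surjective f) (hg : Function.Surjective g) :
    LinearMap.ker (LinearMap.toSpanSingleton (A ⊗[k] B) (M ⊗[k] N) (f 1 ⊗ₜ g 1)) =
      Ideal.map (Algebra.TensorProduct.includeLeft : A →ₐ[k] A ⊗[k] B) (LinearMap.ker f) ⊔
        Ideal.map (Algebra.TensorProduct.includeRight : B →ₐ[k] A ⊗[k] B) (LinearMap.ker g) := by
  have hexact_left : Function.Exact ((LinearMap.ker f).restrictScalars k).subtype
      (f.restrictScalars k) := LinearMap.exact_subtype_ker_map f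
  have hexact_right : Function.Exact ((LinearMap.ker g).restrictScalars k).subtype
      (g.restrictScalars k) := LinearMap.exact_subtype_ker_map g
  apply Submodule.restrictScalars_injective k
  rw [Submodule.restrictScalars_sup, Ideal.map_includeLeft_eq, Ideal.map_includeRight_eq,
    sup_comm, ← TensorProduct.map_ker hexact_left hf hexact_right hg]
  ext x
  rw [Submodule.restrictScalars_mem, LinearMap.mem_ker, LinearMap.mem_ker,
    toSpanSingleton_tmul_apply]

end Cyclic

open scoped ModuleCat in
lemma projectiveDimension_externalTensor_of_surjective (k : Type*) {A B : Type u} [Field k]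
    [CommRing A] [CommRing B] [Algebra k A] [Algebra k B] {M : ModuleCat.{u} A}
    {N : ModuleCat.{u} B} {f : A →ₗ[A] M} (hf : Function.Surjective f) {g : B →ₗ[B] N}
    (hg : Function.Surjective g) :
    projectiveDimension (((externalTensor k A B).obj M).obj N) =
      projectiveDimension (ModuleCat.of (A ⊗[k] B) (A ⊗[k] B ⧸
        (Ideal.map (Algebra.TensorProduct.includeLeft : A →ₐ[k] A ⊗[k] B) (LinearMap.ker f) ⊔
          Ideal.map (Algebra.TensorProduct.includeRight : B →ₐ[k] A ⊗[k] B)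
            (LinearMap.ker g)))) := by
  rw [← ker_toSpanSingleton_tmul hf hg]
  exact projectiveDimension_eq_of_iso (LinearEquiv.toModuleIso
    (LinearMap.quotKerEquivOfSurjective _ (toSpanSingleton_tmul_surjective hf hg))).symm

theorem projectiveDimension_quotient_sup_map (k : Type*) {A B : Type u} [Field k] [CommRing A]
    [CommRing B] [Algebra k A] [Algebra k B] {σ τ : Type u} [SetLike σ A] [AddSubmonoidClass σ A]
    {𝒜 : ℕ → σ} [GradedRing 𝒜] [SetLike τ B] [AddSubmonoidClass τ B] {ℬ : ℕ → τ} [GradedRing ℬ]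
    (h𝒜 : 𝒜₊.toIdeal.IsMaximal)
    (hℬ : ℬ₊.toIdeal.IsMaximal)
    {I : Ideal A} (hI : I.IsHomogeneous 𝒜) {J : Ideal B} (hJ : J.IsHomogeneous ℬ) :
    projectiveDimension (ModuleCat.of (A ⊗[k] B) (A ⊗[k] B ⧸
        (I.map (Algebra.TensorProduct.includeLeft : A →ₐ[k] A ⊗[k] B) ⊔
          J.map (Algebra.TensorProduct.includeRight : B →ₐ[k] A ⊗[k] B)))) =
      projectiveDimension (ModuleCat.of A (A ⧸ I)) +
        projectiveDimension (ModuleCat.of B (B ⧸ J)) := by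
  rw [← projectiveDimension_externalTensor (k := k) _ _ (hasMinimalSyzygy_quotient h𝒜 hI)
    (hasMinimalSyzygy_quotient hℬ hJ), projectiveDimension_externalTensor_of_surjective k
    I.mkQ_surjective J.mkQ_surjective, I.ker_mkQ, J.ker_mkQ]

attribute [local instance] RingHomInvPair.of_ringEquiv in
lemma projectiveDimension_quotient_eq_of_ringEquiv {R : Type u} {R' : Type v} [CommRing R]
    [CommRing R'] (e : R ≃+* R') (I : Ideal R) :
    projectiveDimension (ModuleCat.of R (R ⧸ I)) =
      projectiveDimension (ModuleCat.of R' (R' ⧸ I.map (e : R →+* R'))) := by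
  let q := Ideal.quotientEquiv I _ e rfl
  let e' : (R ⧸ I) ≃ₛₗ[RingHomClass.toRingHom e] (R' ⧸ I.map (e : R →+* R')) :=
    { q with
      map_smul' a x := by
        change q (a • x) = e a • q x
        rw [Algebra.smul_def, Algebra.smul_def, map_mul]
        rfl }
  exact ModuleCat.projectiveDimension_eq_of_semiLinearEquiv.{u, v} (M := ModuleCat.of R (R ⧸ I))
    (N := ModuleCat.of R' (R' ⧸ I.map (e : R →+* R'))) e e'

end Quotient

section Polynomial

open MvPolynomial

attribute [local instance] MvPolynomial.gradedAlgebra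

lemma isMaximal_irrelevant_homogeneousSubmodule (k σ : Type*) [Field k] :
    (HomogeneousIdeal.irrelevant (homogeneousSubmodule σ k)).toIdeal.IsMaximal := by
  have h : (HomogeneousIdeal.irrelevant (homogeneousSubmodule σ k)).toIdeal =
      RingHom.ker (constantCoeff : MvPolynomial σ k →+* k) := by
    ext p
    have hp : (decompose (homogeneousSubmodule σ k) p 0 : MvPolynomial σ k) = C (coeff 0 p) :=
      (decomposition.decompose'_apply p 0).trans (homogeneousComponent_zero p)
    rw [HomogeneousIdeal.toIdeal_irrelevant, RingHom.mem_ker, RingHom.mem_ker,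
      GradedRing.projZeroRingHom_apply, hp, C_eq_zero, constantCoeff_eq]
  rw [h]
  exact RingHom.ker_isMaximal_of_surjective _ fun a ↦ ⟨C a, constantCoeff_C _ a⟩

lemma isHomogeneous_graphIdeal (k : Type*) [Field k] {V : Type*} (G : SimpleGraph V) :
    (G.graphIdeal k).IsHomogeneous (homogeneousSubmodule V k) := by
  refine Ideal.homogeneous_span _ _ ?_
  rintro _ ⟨a, b, -, rfl⟩
  exact ⟨2, (isHomogeneous_X k a).mul (isHomogeneous_X k b)⟩

end Polynomial

section Graph

universe w

open MvPolynomial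

variable (k : Type u) [Field k]

lemma map_renameEquiv_graphIdeal {V V' : Type*} {G : SimpleGraph V} {G' : SimpleGraph V'}
    (φ : G ≃g G') :
    (G.graphIdeal k).map ((renameEquiv k φ.toEquiv).toRingEquiv :
      MvPolynomial V k →+* MvPolynomial V' k) = G'.graphIdeal k := by
  rw [SimpleGraph.graphIdeal, SimpleGraph.graphIdeal, Ideal.map_span]
  congr 1
  ext p
  constructor
  · rintro ⟨_, ⟨a, b, hab, rfl⟩, rfl⟩
    exact ⟨φ a, φ b, φ.map_adj_iff.2 hab, by simp⟩
  · rintro ⟨a, b, hab, rfl⟩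
    exact ⟨_, ⟨φ.symm a, φ.symm b, φ.symm.map_adj_iff.2 hab, rfl⟩, by simp⟩

lemma pd_eq_of_iso {V V' : Type*} {G : SimpleGraph V} {G' : SimpleGraph V'} (φ : G ≃g G') :
    G.pd k = G'.pd k := by
  rw [SimpleGraph.pd, SimpleGraph.pd, ← map_renameEquiv_graphIdeal k φ]
  exact projectiveDimension_quotient_eq_of_ringEquiv _ _

lemma pd_eq_zero_of_isEmpty {V : Type*} [IsEmpty V] (G : SimpleGraph V) : G.pd k = 0 := by
  have h : G.graphIdeal k = ⊥ := by simp [SimpleGraph.graphIdeal]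
  let e : (MvPolynomial V k ⧸ G.graphIdeal k) ≃ₗ[MvPolynomial V k] MvPolynomial V k :=
    Submodule.quotEquivOfEqBot _ h
  have := e.symm.injective.nontrivial
  have : Projective (ModuleCat.of (MvPolynomial V k) (MvPolynomial V k ⧸ G.graphIdeal k)) :=
    (IsProjective.iff_projective _).1 (.of_equiv e.symm)
  exact ModuleCat.projectiveDimension_eq_zero_of_projective _

lemma map_tensorEquivSum_sup_graphIdeal {V₁ V₂ : Type*} (G₁ : SimpleGraph V₁)
    (G₂ : SimpleGraph V₂) :
    ((G₁.graphIdeal k).map (Algebra.TensorProduct.includeLeft :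
        MvPolynomial V₁ k →ₐ[k] MvPolynomial V₁ k ⊗[k] MvPolynomial V₂ k) ⊔
      (G₂.graphIdeal k).map (Algebra.TensorProduct.includeRight :
        MvPolynomial V₂ k →ₐ[k] MvPolynomial V₁ k ⊗[k] MvPolynomial V₂ k)).map
      ((tensorEquivSum k V₁ V₂ k).toRingEquiv :
        MvPolynomial V₁ k ⊗[k] MvPolynomial V₂ k →+* MvPolynomial (V₁ ⊕ V₂) k) =
      (G₁ ⊕g G₂).graphIdeal k := by
  have h₁ (a b : V₁) : tensorEquivSum k V₁ V₂ k ((X a * X b) ⊗ₜ 1) =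
      X (Sum.inl a) * X (Sum.inl b) := by
    rw [← tensorEquivSum_X_tmul_one (R := k) (ι := V₂),
      ← tensorEquivSum_X_tmul_one (R := k) (ι := V₂),
      ← map_mul, Algebra.TensorProduct.tmul_mul_tmul, one_mul]
  have h₂ (a b : V₂) : tensorEquivSum k V₁ V₂ k (1 ⊗ₜ (X a * X b)) =
      X (Sum.inr a) * X (Sum.inr b) := by
    rw [← tensorEquivSum_one_tmul_X (R := k) (σ := V₁),
      ← tensorEquivSum_one_tmul_X (R := k) (σ := V₁),
      ← map_mul, Algebra.TensorProduct.tmul_mul_tmul, one_mul]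
  simp only [SimpleGraph.graphIdeal, Ideal.map_span, ← Ideal.span_union]
  congr 1
  ext p
  constructor
  · rintro ⟨_, ⟨_, ⟨a, b, hab, rfl⟩, rfl⟩ | ⟨_, ⟨a, b, hab, rfl⟩, rfl⟩, rfl⟩
    · exact ⟨Sum.inl a, Sum.inl b, hab, h₁ a b⟩
    · exact ⟨Sum.inr a, Sum.inr b, hab, h₂ a b⟩
  · rintro ⟨a | a, b | b, hab, rfl⟩
    · exact ⟨_, Or.inl ⟨_, ⟨a, b, hab, rfl⟩, rfl⟩, h₁ a b⟩
    · exact absurd hab (by simp)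
    · exact absurd hab (by simp)
    · exact ⟨_, Or.inr ⟨_, ⟨a, b, hab, rfl⟩, rfl⟩, h₂ a b⟩

attribute [local instance] MvPolynomial.gradedAlgebra in
lemma pd_sum {V₁ V₂ : Type v} (G₁ : SimpleGraph V₁) (G₂ : SimpleGraph V₂) :
    (G₁ ⊕g G₂).pd k = G₁.pd k + G₂.pd k := by
  rw [SimpleGraph.pd, SimpleGraph.pd, SimpleGraph.pd, ← map_tensorEquivSum_sup_graphIdeal,
    ← projectiveDimension_quotient_sup_map k (isMaximal_irrelevant_homogeneousSubmodule k V₁)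
      (isMaximal_irrelevant_homogeneousSubmodule k V₂) (isHomogeneous_graphIdeal k G₁)
      (isHomogeneous_graphIdeal k G₂)]
  exact (projectiveDimension_quotient_eq_of_ringEquiv _ _).symm

lemma pd_eq_add_of_iso_sum {V₁ : Type v} {V₂ : Type w} {V : Type*} {G₁ : SimpleGraph V₁}
    {G₂ : SimpleGraph V₂} {G : SimpleGraph V} (φ : G ≃g G₁ ⊕g G₂) :
    G.pd k = G₁.pd k + G₂.pd k := by
  let φ₁ := SimpleGraph.Iso.map Equiv.ulift.{w}.symm G₁
  let φ₂ := SimpleGraph.Iso.map Equiv.ulift.{v}.symm G₂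
  rw [pd_eq_of_iso k φ₁, pd_eq_of_iso k φ₂, ← pd_sum,
    pd_eq_of_iso k (φ.trans (SimpleGraph.Iso.sumCongr φ₁ φ₂))]

open Classical in
/-- If no edge joins two disjoint sets of vertices, then the graph induced on their union is the
disjoint union of the two induced graphs; this splits off one connected component at a time. -/
noncomputable def isoInduceUnion {V : Type*} {G : SimpleGraph V} {U W : Set V} (hUW : Disjoint U W)
    (hadj : ∀ u ∈ U, ∀ w ∈ W, ¬ G.Adj u w) : G.induce (U ∪ W) ≃g G.induce U ⊕g G.induce W :=
  .symm
  { toEquiv := (Equiv.Set.union hUW).symm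
    map_rel_iff' := by
      rintro (⟨u, hu⟩ | ⟨u, hu⟩) (⟨w, hw⟩ | ⟨w, hw⟩)
      · simp
      · simp [hadj u hu w hw]
      · simp [G.adj_comm u w, hadj w hw u hu]
      · simp }

lemma pd_induce_components {V : Type*} (G : SimpleGraph V) (s : Finset G.ConnectedComponent) :
    (G.induce {v | G.connectedComponentMk v ∈ s}).pd k = ∑ C ∈ s, C.toSimpleGraph.pd k := by
  classical
  induction s using Finset.induction_on with
  | empty =>
    have : IsEmpty {v | G.connectedComponentMk v ∈ (∅ : Finset G.ConnectedComponent)} := by simp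
    rw [pd_eq_zero_of_isEmpty, Finset.sum_empty]
  | insert C s hC ih =>
    have hunion : {v | G.connectedComponentMk v ∈ insert C s} =
        C.supp ∪ {v | G.connectedComponentMk v ∈ s} := by
      ext v
      simp
    have hdisj : Disjoint C.supp {v | G.connectedComponentMk v ∈ s} :=
      Set.disjoint_left.2 fun v hv hvs ↦ hC (hv ▸ hvs)
    have hadj : ∀ v ∈ C.supp, ∀ w ∈ {v | G.connectedComponentMk v ∈ s}, ¬ G.Adj v w :=
      fun v hv w hw h ↦ hC ((C.mem_supp_of_adj_mem_supp hv h) ▸ hw)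
    rw [Finset.sum_insert hC, ← ih, hunion]
    exact pd_eq_add_of_iso_sum k (isoInduceUnion hdisj hadj)

end Graph

theorem mainTheorem8_general {k : Type*} [Field k] :
    (∀ {V₁ : Type*} {V₂ : Type*} {V : Type*}
      (G₁ : SimpleGraph V₁) (G₂ : SimpleGraph V₂) (G : SimpleGraph V),
      Nonempty (G ≃g G₁ ⊕g G₂) → G.pd k = G₁.pd k + G₂.pd k) ∧
    (∀ {V : Type*} (G : SimpleGraph V) [Fintype G.ConnectedComponent],
      G.pd k = ∑ C : G.ConnectedComponent, C.toSimpleGraph.pd k) := by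
  refine ⟨fun G₁ G₂ G ⟨φ⟩ ↦ pd_eq_add_of_iso_sum k φ, fun {V} G _ ↦ ?_⟩
  rw [← pd_induce_components]
  exact pd_eq_of_iso k (.mk (Equiv.subtypeUnivEquiv (by simp)).symm Iff.rfl)

theorem mainTheorem8 {k : Type*} [Field k] :
    (∀ {V₁ : Type*} {V₂ : Type*} {V : Type*} [Finite V₁] [Finite V₂] [Finite V]
      (G₁ : SimpleGraph V₁) (G₂ : SimpleGraph V₂) (G : SimpleGraph V),
      Nonempty (G ≃g G₁ ⊕g G₂) → G.pd k = G₁.pd k + G₂.pd k) ∧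
    (∀ {V : Type*} [Finite V] (G : SimpleGraph V) [Fintype G.ConnectedComponent],
      G.pd k = ∑ C : G.ConnectedComponent, C.toSimpleGraph.pd k) := by
  obtain ⟨hsum, hcomponents⟩ := mainTheorem8_general (k := k)
  exact ⟨fun G₁ G₂ G ↦ hsum G₁ G₂ G, fun G ↦ hcomponents G⟩
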